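/- Let $N\ge 1$ be an integer, let $\eta>0$, and let $H$ be a positive definite Hermitian $N\times N$ matrix with pairwise distinct eigenvalues $E_1,\dots,E_N>0$. Write $d\Phi=\prod_i d\Phi_{ii}\prod_{k<l}d(\operatorname{Re}\Phi_{kl})\,d(\operatorname{Im}\Phi_{kl})$ for the Lebesgue measure on the space $h_N$ of Hermitian $N\times N$ matrices, and define the partition function $$Z=\int_{h_N} e^{-S(\Phi)}\,d\Phi,\qquad S(\Phi)=N\,\mathrm{Tr}\Big(H\Phi^2+\frac{\eta}{4}\Phi^4\Big).$$ Then the integral converges absolutely, $Z=Z(E,\eta)$ depends only on $\eta$ and on the eigenvalues $E=(E_1,\dots,E_N)$ of $H$, the function $E\mapsto Z(E,\eta)$ is twice continuously differentiable on the set of all $E$ with positive, pairwise distinct entries, and on this set it satisfies $$\mathcal L_{SD}\,Z(E,\eta)=0,$$ where $$\mathcal L_{SD}=\frac{\eta}{N}\sum_{i=1}^N\frac{\partial^2}{\partial E_i^2}+\frac{\eta}{N}\sum_{\substack{i,j=1\\ i\ne j}}^N\frac{1}{E_i-E_j}\Big(\frac{\partial}{\partial E_i}-\frac{\partial}{\partial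 E_j}\Big)-2\sum_{k=1}^N E_k\frac{\partial}{\partial E_k}-N^2 .$$ -/

import Mathlib

open scoped ComplexOrder

noncomputable section

namespace PhiFour

/-- The real coordinates of a Hermitian `N × N` matrix `Φ`: the diagonal entries `Φ_ii`, and the
pairs `(Re Φ_kl, Im Φ_kl)` for `k < l`. Its `volume` is the product Lebesgue measure
`∏ dΦ_ii ∏_{k<l} dΦ_kl^Re dΦ_kl^Im`. -/
abbrev HermCoord (N : ℕ) : Type :=
  (Fin N → ℝ) × ({p : Fin N × Fin N // p.1 < p.2} → ℝ × ℝ)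

/-- The Hermitian matrix with given real coordinates. -/
def hermMatrix {N : ℕ} (x : HermCoord N) : Matrix (Fin N) (Fin N) ℂ :=
  Matrix.of fun i j =>
    if h : i < j then ⟨(x.2 ⟨(i, j), h⟩).1, (x.2 ⟨(i, j), h⟩).2⟩
    else if h : j < i then ⟨(x.2 ⟨(j, i), h⟩).1, -(x.2 ⟨(j, i), h⟩).2⟩
    else (x.1 i : ℂ)

theorem hermMatrix_isHermitian {N : ℕ} (x : HermCoord N) : (hermMatrix x).IsHermitian := by
  ext i j
  rcases lt_trichotomy i j with h | h | h
  · simp [hermMatrix, h, h.not_gt, Complex.ext_iff]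
  · subst h
    simp [hermMatrix]
  · simp [hermMatrix, h, h.not_gt, Complex.ext_iff]

/-- The action `S = N Tr (H Φ² + (η/4) Φ⁴)`. For Hermitian `H` and `Φ` the trace is a real number
(see `action_eq`), so that taking the real part only changes its type. -/
def action {N : ℕ} (H : Matrix (Fin N) (Fin N) ℂ) (η : ℝ) (Φ : Matrix (Fin N) (Fin N) ℂ) : ℝ :=
  ((N : ℂ) * (H * Φ ^ 2 + ((η / 4 : ℝ) : ℂ) • Φ ^ 4).trace).re

theorem action_eq {N : ℕ} {H Φ : Matrix (Fin N) (Fin N) ℂ} (hH : H.IsHermitian)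
    (hΦ : Φ.IsHermitian) (η : ℝ) :
    ((action H η Φ : ℝ) : ℂ) = (N : ℂ) * (H * Φ ^ 2 + ((η / 4 : ℝ) : ℂ) • Φ ^ 4).trace := by
  unfold action
  rw [← Complex.conj_eq_iff_re]
  have h2 : star (H * Φ ^ 2).trace = (H * Φ ^ 2).trace := by
    rw [← Matrix.trace_conjTranspose, Matrix.conjTranspose_mul, hH.eq, (hΦ.pow 2).eq,
      Matrix.trace_mul_comm]
  have h4 : star (Φ ^ 4).trace = (Φ ^ 4).trace := by
    rw [← Matrix.trace_conjTranspose, (hΦ.pow 4).eq]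
  rw [Matrix.trace_add, Matrix.trace_smul, map_mul, map_add, smul_eq_mul, map_mul,
    Complex.conj_ofReal, starRingEnd_apply, starRingEnd_apply, starRingEnd_apply, h2, h4]
  simp

/-- The Boltzmann weight `e^{-S}` in the real coordinates of `Φ`. -/
def weight {N : ℕ} (H : Matrix (Fin N) (Fin N) ℂ) (η : ℝ) (x : HermCoord N) : ℝ :=
  Real.exp (-action H η (hermMatrix x))

/-- The partition function `∫ dΦ e^{-S}` with external matrix `H`. -/
def matrixPartition {N : ℕ} (H : Matrix (Fin N) (Fin N) ℂ) (η : ℝ) : ℝ :=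
  ∫ x : HermCoord N, weight H η x

/-- The partition function `Z(E, η)` as a function of the eigenvalues `E_1, …, E_N` of the external
matrix, computed at the representative `diag(E_1, …, E_N)`. -/
def partitionFunction {N : ℕ} (η : ℝ) (E : Fin N → ℝ) : ℝ :=
  matrixPartition (Matrix.diagonal fun i => (E i : ℂ)) η

/-- The partial derivative `∂f/∂E_i`. -/
def partialE {N : ℕ} (i : Fin N) (f : (Fin N → ℝ) → ℝ) (E : Fin N → ℝ) : ℝ :=
  lineDeriv ℝ f E (Pi.single i 1)

/-- The Schwinger–Dyson operator in the eigenvalue variables. -/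
def schwingerDyson {N : ℕ} (η : ℝ) (f : (Fin N → ℝ) → ℝ) (E : Fin N → ℝ) : ℝ :=
  η / N * ∑ i, partialE i (partialE i f) E
    + η / N * ∑ i, ∑ j ∈ Finset.univ.erase i,
        (E i - E j)⁻¹ * (partialE i f E - partialE j f E)
    - 2 * ∑ k, E k * partialE k f E
    - (N : ℝ) ^ 2 * f E

end PhiFour

end

/-! As a function of the external matrix `H`, the partition function is a Laplace transform: `Z(H) =
∫ exp (source x H) * quarticWeight η x`, where `source x H = -N Re Tr (H Φ²)` is linear in `H`. The
source grows quadratically in `Φ` and the quartic weight decays faster than any such exponential, so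
`Z` is smooth on the whole array space and each derivative in a direction `K` inserts a factor `-N
Re Tr (K Φ²)`.

Three facts then give the equation. Dilations: invariance of `c ^ (N²) * ∫ exp (-S(cΦ))` in `c`,
differentiated at `c = 1`, gives `N² Z + 2 DZ(H)[H] = N η ∫ Tr Φ⁴ e^{-S}` (`dilation_identity`).
Laplacian: `N² Tr Φ⁴ = ∑ |N (Φ²)_ij|²` is a sum of squares of sources, so the quartic moment is a
sum of second derivatives of `Z` over Hermitian directions (`trace_pow_four_eq`). Unitary
invariance: `Z(U H Uᴴ) = Z(H)`, expanded to second order along `e^{tX}`, turns the off-diagonal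
second derivatives at `diag(E)` into `2 (∂_i Z - ∂_j Z) / (E_i - E_j)`
(`laplaceIntegralDeriv2_commutator`, `laplaceIntegralDeriv2_eq`). This is the radial part of the
Laplacian on Hermitian matrices. -/

/-! ### Differentiating Laplace type integrals. -/

open MeasureTheory in
/-- Differentiation under the integral sign for Laplace type integrals. -/
theorem hasFDerivAt_integral_exp_smul {X V W : Type*} [MeasurableSpace X] {μ : Measure X}
    [NormedAddCommGroup V] [NormedSpace ℝ V] [NormedAddCommGroup W] [NormedSpace ℝ W]
    {a : X → V →L[ℝ] ℝ} {h : X → W} (ha : AEStronglyMeasurable a μ)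
    (hh : AEStronglyMeasurable h μ)
    (hint : ∀ R : ℝ, Integrable (fun x => Real.exp (R * ‖a x‖) * ‖h x‖) μ) (v : V) :
    HasFDerivAt (fun v => ∫ x, Real.exp (a x v) • h x ∂μ)
      (∫ x, Real.exp (a x v) • (a x).smulRight (h x) ∂μ) v := by
  have hexp : ∀ u : V, AEStronglyMeasurable (fun x => Real.exp (a x u)) μ := fun u =>
    Real.continuous_exp.comp_aestronglyMeasurable ((ContinuousLinearMap.apply ℝ ℝ u).continuous.comp_aestronglyMeasurable ha)
  have hsr : AEStronglyMeasurable (fun x => (a x).smulRight (h x)) μ :=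
    (ContinuousLinearMap.smulRightL ℝ V W).continuous₂.comp_aestronglyMeasurable (ha.prodMk hh)
  have hle : ∀ (x : X) (u : V), a x u ≤ ‖u‖ * ‖a x‖ := fun x u =>
    (le_abs_self _).trans (((a x).le_opNorm u).trans_eq (mul_comm _ _))
  refine hasFDerivAt_integral_of_dominated_of_fderiv_le (𝕜 := ℝ)
    (F := fun v x => Real.exp (a x v) • h x)
    (F' := fun v x => Real.exp (a x v) • (a x).smulRight (h x))
    -- On the unit ball around `v` the exponent costs `‖v‖ + 1`; the factor `‖a x‖` from the
    -- derivative is absorbed by one more `exp ‖a x‖`.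
    (bound := fun x => Real.exp ((‖v‖ + 2) * ‖a x‖) * ‖h x‖) (Metric.ball_mem_nhds v one_pos)
    ?_ ?_ ?_ ?_ (hint _) ?_
  · exact Filter.Eventually.of_forall fun u => (hexp u).smul hh
  · refine (hint ‖v‖).mono' ((hexp v).smul hh) (Filter.Eventually.of_forall fun x => ?_)
    rw [norm_smul, Real.norm_eq_abs, Real.abs_exp]
    gcongr
    exact hle x v
  · exact (hexp v).smul hsr
  · refine Filter.Eventually.of_forall fun x u hu => ?_
    rw [norm_smul, Real.norm_eq_abs, Real.abs_exp, ContinuousLinearMap.norm_smulRight_apply,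
      ← mul_assoc]
    gcongr
    have hu' : ‖u‖ ≤ ‖v‖ + 1 := by
      have := norm_le_norm_add_norm_sub' u v
      rw [mem_ball_iff_norm] at hu
      linarith
    have h1 : ‖a x‖ ≤ Real.exp ‖a x‖ := by linarith [Real.add_one_le_exp ‖a x‖]
    calc Real.exp (a x u) * ‖a x‖ ≤ Real.exp ((‖v‖ + 1) * ‖a x‖) * Real.exp ‖a x‖ := by
          gcongr
          exact (hle x u).trans (by gcongr)
      _ = Real.exp ((‖v‖ + 2) * ‖a x‖) := by rw [← Real.exp_add]; ring_nf
  · refine Filter.Eventually.of_forall fun x u _ => ?_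
    have := ((a x).hasFDerivAt (x := u)).exp.smul_const (h x)
    convert this using 1
    ext w
    simp [smul_smul]

open MeasureTheory in
-- The hypothesis `hint` survives replacing `h` by the integrand of the derivative, because it is
-- assumed for every `R`: raising `R` by one pays for the extra `‖a x‖`. Differentiation can
-- therefore be iterated.
theorem integrable_exp_mul_norm_smulRight {X V W : Type*} [MeasurableSpace X] {μ : Measure X}
    [NormedAddCommGroup V] [NormedSpace ℝ V] [NormedAddCommGroup W] [NormedSpace ℝ W]
    {a : X → V →L[ℝ] ℝ} {h : X → W} (ha : AEStronglyMeasurable a μ)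
    (hh : AEStronglyMeasurable h μ)
    (hint : ∀ R : ℝ, Integrable (fun x => Real.exp (R * ‖a x‖) * ‖h x‖) μ) (R : ℝ) :
    Integrable (fun x => Real.exp (R * ‖a x‖) * ‖(a x).smulRight (h x)‖) μ := by
  have hsr : AEStronglyMeasurable (fun x => (a x).smulRight (h x)) μ :=
    (ContinuousLinearMap.smulRightL ℝ V W).continuous₂.comp_aestronglyMeasurable (ha.prodMk hh)
  refine (hint (R + 1)).mono' ((Real.continuous_exp.comp_aestronglyMeasurable
    (ha.norm.const_mul R)).mul hsr.norm) (Filter.Eventually.of_forall fun x => ?_)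
  rw [norm_mul, Real.norm_eq_abs, Real.abs_exp, norm_norm,
    ContinuousLinearMap.norm_smulRight_apply, ← mul_assoc, add_mul, Real.exp_add, one_mul]
  gcongr
  linarith [Real.add_one_le_exp ‖a x‖]

open MeasureTheory in
-- The derivative is an integral of the same kind with values in `V →L[ℝ] W`, so the induction on
-- `n` must let `W` and `h` vary.
theorem contDiff_integral_exp_smul {X V : Type} [MeasurableSpace X] {μ : Measure X}
    [NormedAddCommGroup V] [NormedSpace ℝ V] {a : X → V →L[ℝ] ℝ} (ha : AEStronglyMeasurable a μ)
    (n : ℕ) : ∀ {W : Type} [NormedAddCommGroup W] [NormedSpace ℝ W] {h : X → W},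
    AEStronglyMeasurable h μ →
    (∀ R : ℝ, Integrable (fun x => Real.exp (R * ‖a x‖) * ‖h x‖) μ) →
    ContDiff ℝ n (fun v => ∫ x, Real.exp (a x v) • h x ∂μ) := by
  induction n with
  | zero =>
    intro W _ _ h hh hint
    rw [Nat.cast_zero, contDiff_zero, continuous_iff_continuousAt]
    exact fun v => (hasFDerivAt_integral_exp_smul ha hh hint v).continuousAt
  | succ n ih =>
    intro W _ _ h hh hint
    rw [Nat.cast_succ, contDiff_succ_iff_hasFDerivAt]
    refine ⟨_, ?_, hasFDerivAt_integral_exp_smul ha hh hint⟩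
    exact ih ((ContinuousLinearMap.smulRightL ℝ V W).continuous₂.comp_aestronglyMeasurable (ha.prodMk hh))
      (integrable_exp_mul_norm_smulRight ha hh hint)

open MeasureTheory in
theorem integrable_exp_smul {X V W : Type*} [MeasurableSpace X] {μ : Measure X}
    [NormedAddCommGroup V] [NormedSpace ℝ V] [NormedAddCommGroup W] [NormedSpace ℝ W]
    {a : X → V →L[ℝ] ℝ} {h : X → W} (ha : AEStronglyMeasurable a μ)
    (hh : AEStronglyMeasurable h μ)
    (hint : ∀ R : ℝ, Integrable (fun x => Real.exp (R * ‖a x‖) * ‖h x‖) μ) (v : V) :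
    Integrable (fun x => Real.exp (a x v) • h x) μ := by
  have hexp : AEStronglyMeasurable (fun x => Real.exp (a x v)) μ :=
    Real.continuous_exp.comp_aestronglyMeasurable
      ((ContinuousLinearMap.apply ℝ ℝ v).continuous.comp_aestronglyMeasurable ha)
  refine (hint ‖v‖).mono' (hexp.smul hh) (Filter.Eventually.of_forall fun x => ?_)
  rw [norm_smul, Real.norm_eq_abs, Real.abs_exp]
  gcongr
  exact (le_abs_self _).trans (((a x).le_opNorm v).trans_eq (mul_comm _ _))

noncomputable section

section Laplace

set_option maxSynthPendingDepth 4

open MeasureTheory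

variable {X V : Type} [MeasurableSpace X] [NormedAddCommGroup V] [NormedSpace ℝ V]

/-- The Laplace type integral `∫ exp (a x v) g x dμ`. -/
def laplaceIntegral (μ : Measure X) (a : X → V →L[ℝ] ℝ) (g : X → ℝ) (v : V) : ℝ :=
  ∫ x, Real.exp (a x v) • g x ∂μ

/-- The derivative of `laplaceIntegral`. -/
def laplaceIntegralDeriv (μ : Measure X) (a : X → V →L[ℝ] ℝ) (g : X → ℝ) (v : V) : V →L[ℝ] ℝ :=
  ∫ x, Real.exp (a x v) • (a x).smulRight (g x) ∂μ

/-- The second derivative of `laplaceIntegral`. -/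
def laplaceIntegralDeriv2 (μ : Measure X) (a : X → V →L[ℝ] ℝ) (g : X → ℝ) (v : V) :
    V →L[ℝ] V →L[ℝ] ℝ :=
  ∫ x, Real.exp (a x v) • (a x).smulRight ((a x).smulRight (g x)) ∂μ

variable {μ : Measure X} {a : X → V →L[ℝ] ℝ} {g : X → ℝ} (ha : AEStronglyMeasurable a μ)
  (hg : AEStronglyMeasurable g μ)
  (hint : ∀ R : ℝ, Integrable (fun x => Real.exp (R * ‖a x‖) * ‖g x‖) μ) (v K L : V)

theorem MeasureTheory.AEStronglyMeasurable.clm_smulRight {W : Type*} [NormedAddCommGroup W]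
    [NormedSpace ℝ W] (ha : AEStronglyMeasurable a μ) {h : X → W} (hh : AEStronglyMeasurable h μ) :
    AEStronglyMeasurable (fun x => (a x).smulRight (h x)) μ :=
  (ContinuousLinearMap.smulRightL ℝ V W).continuous₂.comp_aestronglyMeasurable (ha.prodMk hh)

include ha hg hint

theorem hasFDerivAt_laplaceIntegral :
    HasFDerivAt (laplaceIntegral μ a g) (laplaceIntegralDeriv μ a g v) v :=
  hasFDerivAt_integral_exp_smul ha hg hint v

theorem hasFDerivAt_laplaceIntegralDeriv :
    HasFDerivAt (laplaceIntegralDeriv μ a g) (laplaceIntegralDeriv2 μ a g v) v :=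
  hasFDerivAt_integral_exp_smul ha (ha.clm_smulRight hg)
    (integrable_exp_mul_norm_smulRight ha hg hint) v

theorem integrable_exp_smul_smulRight :
    Integrable (fun x => Real.exp (a x v) • (a x).smulRight (g x)) μ :=
  integrable_exp_smul ha (ha.clm_smulRight hg) (integrable_exp_mul_norm_smulRight ha hg hint) v

theorem integrable_exp_smul_smulRight_smulRight :
    Integrable (fun x => Real.exp (a x v) • (a x).smulRight ((a x).smulRight (g x))) μ :=
  integrable_exp_smul ha (ha.clm_smulRight (ha.clm_smulRight hg))
    (integrable_exp_mul_norm_smulRight ha (ha.clm_smulRight hg)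
      (integrable_exp_mul_norm_smulRight ha hg hint)) v

theorem integrable_apply_mul_exp :
    Integrable (fun x => a x K * (Real.exp (a x v) * g x)) μ := by
  refine ((integrable_exp_smul_smulRight ha hg hint v).apply_continuousLinearMap K).congr
    (Filter.Eventually.of_forall fun x => ?_)
  simp only [smul_apply, ContinuousLinearMap.smulRight_apply, smul_eq_mul]
  ring

theorem integrable_apply_mul_apply_mul_exp :
    Integrable (fun x => a x K * a x L * (Real.exp (a x v) * g x)) μ := by
  refine (((integrable_exp_smul_smulRight_smulRight ha hg hint v).apply_continuousLinearMap
    K).apply_continuousLinearMap L).congr (Filter.Eventually.of_forall fun x => ?_)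
  simp only [smul_apply, ContinuousLinearMap.smulRight_apply, smul_eq_mul]
  ring

theorem laplaceIntegralDeriv_apply :
    laplaceIntegralDeriv μ a g v K = ∫ x, a x K * (Real.exp (a x v) * g x) ∂μ := by
  rw [laplaceIntegralDeriv,
    ContinuousLinearMap.integral_apply (integrable_exp_smul_smulRight ha hg hint v)]
  refine integral_congr_ae (Filter.Eventually.of_forall fun x => ?_)
  simp only [smul_apply, ContinuousLinearMap.smulRight_apply, smul_eq_mul]
  ring

theorem laplaceIntegralDeriv2_apply :
    laplaceIntegralDeriv2 μ a g v K L = ∫ x, a x K * a x L * (Real.exp (a x v) * g x) ∂μ := by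
  have h := integrable_exp_smul_smulRight_smulRight ha hg hint v
  rw [laplaceIntegralDeriv2, ContinuousLinearMap.integral_apply h,
    ContinuousLinearMap.integral_apply (h.apply_continuousLinearMap K)]
  refine integral_congr_ae (Filter.Eventually.of_forall fun x => ?_)
  simp only [smul_apply, ContinuousLinearMap.smulRight_apply, smul_eq_mul]
  ring

end Laplace
end

/-! ### Hermitian coordinates and the quartic lower bound. -/

noncomputable section

namespace PhiFour

variable {N : ℕ}

theorem hermMatrix_add (x y : HermCoord N) : hermMatrix (x + y) = hermMatrix x + hermMatrix y := by
  ext i j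
  rcases lt_trichotomy i j with h | h | h
  · simp [hermMatrix, h, Complex.ext_iff]
  · subst h; simp [hermMatrix]
  · simp [hermMatrix, h, h.not_gt, Complex.ext_iff, add_comm]

theorem hermMatrix_smul (c : ℝ) (x : HermCoord N) : hermMatrix (c • x) = c • hermMatrix x := by
  ext i j
  rcases lt_trichotomy i j with h | h | h
  · simp [hermMatrix, h, Complex.ext_iff]
  · subst h; simp [hermMatrix]
  · simp [hermMatrix, h, h.not_gt, Complex.ext_iff]

/-- `hermMatrix` as a continuous real-linear map into the arrays with the sup norm. -/
def hermCLM (N : ℕ) : HermCoord N →L[ℝ] (Fin N → Fin N → ℂ) :=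
  LinearMap.toContinuousLinearMap
    { toFun := fun x i j => hermMatrix x i j
      map_add' := fun x y => funext₂ fun i j => congrFun₂ (hermMatrix_add x y) i j
      map_smul' := fun c x => funext₂ fun i j => congrFun₂ (hermMatrix_smul c x) i j }

/-- The real coordinates of (the upper triangle of) a matrix. -/
def hermCoord (A : Matrix (Fin N) (Fin N) ℂ) : HermCoord N :=
  (fun i => (A i i).re, fun p => ((A p.1.1 p.1.2).re, (A p.1.1 p.1.2).im))

theorem hermMatrix_hermCoord {A : Matrix (Fin N) (Fin N) ℂ} (hA : A.IsHermitian) :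
    hermMatrix (hermCoord A) = A := by
  ext i j
  rcases lt_trichotomy i j with h | h | h
  · simp [hermMatrix, hermCoord, h]
  · subst h
    have := hA.apply i i
    simp [hermMatrix, hermCoord]
    exact Complex.conj_eq_iff_re.1 this
  · have := hA.apply i j
    simp [hermMatrix, hermCoord, h, h.not_gt]
    rw [← this]
    simp [Complex.ext_iff]

theorem hermCoord_hermMatrix (x : HermCoord N) : hermCoord (hermMatrix x) = x := by
  refine Prod.ext ?_ ?_
  · funext i
    simp [hermCoord, hermMatrix]
  · funext ⟨⟨i, j⟩, h⟩
    simp at h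
    simp [hermCoord, hermMatrix, h]

theorem continuous_hermMatrix : Continuous (hermMatrix : HermCoord N → _) :=
  (hermCLM N).continuous

theorem exists_norm_hermMatrix_le (N : ℕ) :
    ∃ C : ℝ, 0 ≤ C ∧ ∀ (x : HermCoord N) (i j : Fin N), ‖hermMatrix x i j‖ ≤ C * ‖x‖ :=
  ⟨_, norm_nonneg _, fun x i j => ((norm_le_pi_norm (hermCLM N x i) j).trans
    (norm_le_pi_norm (hermCLM N x) i)).trans ((hermCLM N).le_opNorm x)⟩

/-- The coordinate norm is bounded by any common bound on the matrix entries. -/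
theorem norm_le_of_entry_le {x : HermCoord N} {r : ℝ} (hr : 0 ≤ r)
    (h : ∀ i j, ‖hermMatrix x i j‖ ≤ r) : ‖x‖ ≤ r := by
  rw [← hermCoord_hermMatrix x, hermCoord, Prod.norm_def, max_le_iff,
    pi_norm_le_iff_of_nonneg hr, pi_norm_le_iff_of_nonneg hr]
  refine ⟨fun i => (Complex.abs_re_le_norm _).trans (h i i), fun p => ?_⟩
  rw [Prod.norm_def, max_le_iff]
  exact ⟨(Complex.abs_re_le_norm _).trans (h _ _), (Complex.abs_im_le_norm _).trans (h _ _)⟩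

theorem trace_sq_re {A : Matrix (Fin N) (Fin N) ℂ} (hA : A.IsHermitian) :
    (A ^ 2).trace.re = ∑ i, ∑ j, ‖A i j‖ ^ 2 := by
  rw [pow_two, Matrix.trace, Complex.re_sum]
  refine Finset.sum_congr rfl fun i _ => ?_
  rw [Matrix.diag_apply, Matrix.mul_apply, Complex.re_sum]
  refine Finset.sum_congr rfl fun j _ => ?_
  rw [← hA.apply j i, ← Complex.normSq_eq_norm_sq, RCLike.star_def, Complex.mul_conj,
    Complex.ofReal_re]

theorem sq_apply_self {A : Matrix (Fin N) (Fin N) ℂ} (hA : A.IsHermitian) (i : Fin N) :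
    (A ^ 2) i i = ((∑ j, ‖A i j‖ ^ 2 : ℝ) : ℂ) := by
  rw [pow_two, Matrix.mul_apply, Complex.ofReal_sum]
  refine Finset.sum_congr rfl fun j _ => ?_
  rw [← hA.apply j i, ← Complex.normSq_eq_norm_sq, RCLike.star_def, Complex.mul_conj]

/-- Coercivity of the quartic term: `|Φ_ij|² ≤ (Φ²)_ii`, and `Tr Φ⁴ = ∑ |(Φ²)_ij|²` dominates each
`(Φ²)_ii²`. -/
theorem norm_pow_four_le_trace (x : HermCoord N) :
    ‖x‖ ^ 4 ≤ (hermMatrix x ^ 4).trace.re := by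
  have hH := hermMatrix_isHermitian x
  set A := hermMatrix x with hA
  have h4 : (A ^ 4).trace.re = ∑ i, ∑ j, ‖(A ^ 2) i j‖ ^ 2 := by
    rw [← trace_sq_re (hH.pow 2), ← pow_mul]
  have hT : 0 ≤ (A ^ 4).trace.re := h4.symm ▸ Finset.sum_nonneg fun _ _ => Finset.sum_nonneg fun _ _ => sq_nonneg _
  have key : ∀ i j, ‖A i j‖ ^ 4 ≤ (A ^ 4).trace.re := fun i j => by
    have h1 : ‖A i j‖ ^ 2 ≤ ‖(A ^ 2) i i‖ := by
      rw [sq_apply_self hH, Complex.norm_real, Real.norm_of_nonneg (by positivity)]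
      exact Finset.single_le_sum (f := fun j => ‖A i j‖ ^ 2) (fun _ _ => by positivity)
        (Finset.mem_univ j)
    calc ‖A i j‖ ^ 4 = (‖A i j‖ ^ 2) ^ 2 := by ring
      _ ≤ ‖(A ^ 2) i i‖ ^ 2 := by gcongr
      _ ≤ ∑ j, ‖(A ^ 2) i j‖ ^ 2 := Finset.single_le_sum (f := fun j => ‖(A ^ 2) i j‖ ^ 2)
        (fun _ _ => sq_nonneg _) (Finset.mem_univ i)
      _ ≤ ∑ i, ∑ j, ‖(A ^ 2) i j‖ ^ 2 := Finset.single_le_sum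
        (f := fun i => ∑ j, ‖(A ^ 2) i j‖ ^ 2)
        (fun _ _ => Finset.sum_nonneg fun _ _ => sq_nonneg _) (Finset.mem_univ i)
      _ = (A ^ 4).trace.re := h4.symm
  set r := Real.sqrt (Real.sqrt (A ^ 4).trace.re)
  have hr : r ^ 4 = (A ^ 4).trace.re := by
    rw [pow_mul r 2 2, Real.sq_sqrt (Real.sqrt_nonneg _), Real.sq_sqrt hT]
  have hr0 : 0 ≤ r := Real.sqrt_nonneg _
  rw [← hr]
  gcongr
  refine norm_le_of_entry_le hr0 fun i j => ?_
  have := key i j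
  rw [← hr] at this
  exact le_of_pow_le_pow_left₀ (by norm_num) hr0 this

/-! ### Integrability under quartic decay. -/

open MeasureTheory in
theorem integrable_exp_sub_pow_four {V : Type*} [NormedAddCommGroup V] [NormedSpace ℝ V]
    [FiniteDimensional ℝ V] [MeasurableSpace V] [BorelSpace V] (μ : Measure V) [μ.IsAddHaarMeasure]
    (R : ℝ) {b : ℝ} (hb : 0 < b) :
    Integrable (fun x : V => Real.exp (R * ‖x‖ ^ 2 - b * ‖x‖ ^ 4)) μ := by
  set n := Module.finrank ℝ V + 1
  have h1 := (integrable_one_add_norm (E := V) (μ := μ) (r := (n : ℝ))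
    (by simp [n])).const_mul (Real.exp ((R + 1) ^ 2 / (4 * b) + 5 / 4) * n.factorial)
  refine h1.mono' (Continuous.aestronglyMeasurable (by fun_prop))
    (Filter.Eventually.of_forall fun x => ?_)
  rw [Real.norm_eq_abs, Real.abs_exp, Real.rpow_neg (by positivity), Real.rpow_natCast]
  -- Completing the square bounds `(R + 1) t² - b t⁴` by `(R + 1)² / (4b)`, and the spare `-t²` is
  -- at most `1/4 - t = 5/4 - (1 + t)`. The linear exponential then beats `(1 + t) ^ n` with `n`
  -- above the dimension.
  have hle : R * ‖x‖ ^ 2 - b * ‖x‖ ^ 4 ≤ ((R + 1) ^ 2 / (4 * b) + 5 / 4) + -(1 + ‖x‖) := by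
    have e : (R + 1) ^ 2 / (4 * b) = (R + 1) * ‖x‖ ^ 2 - b * ‖x‖ ^ 4
        + (b * ‖x‖ ^ 2 - (R + 1) / 2) ^ 2 / b := by
      field_simp
      ring
    have : 0 ≤ (b * ‖x‖ ^ 2 - (R + 1) / 2) ^ 2 / b := by positivity
    nlinarith [sq_nonneg (‖x‖ - 1 / 2)]
  have hf := Real.pow_div_factorial_le_exp (1 + ‖x‖) (by positivity) n
  calc _ ≤ Real.exp (((R + 1) ^ 2 / (4 * b) + 5 / 4) + -(1 + ‖x‖)) := Real.exp_le_exp.2 hle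
    _ = Real.exp ((R + 1) ^ 2 / (4 * b) + 5 / 4) * (Real.exp (1 + ‖x‖))⁻¹ := by
      rw [Real.exp_add, Real.exp_neg]
    _ ≤ Real.exp ((R + 1) ^ 2 / (4 * b) + 5 / 4) * ((1 + ‖x‖) ^ n / n.factorial)⁻¹ := by
      gcongr
    _ = _ := by rw [inv_div]; ring

open MeasureTheory in
instance isAddHaarMeasure_volume_hermCoord :
    (volume : Measure (HermCoord N)).IsAddHaarMeasure := by
  have : (volume : Measure (ℝ × ℝ)).IsAddHaarMeasure :=
    inferInstanceAs (Measure.prod volume volume).IsAddHaarMeasure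
  have : (volume : Measure (Fin N → ℝ)).IsAddHaarMeasure :=
    inferInstanceAs (Measure.pi fun _ => volume).IsAddHaarMeasure
  have : (volume : Measure ({p : Fin N × Fin N // p.1 < p.2} → ℝ × ℝ)).IsAddHaarMeasure :=
    inferInstanceAs (Measure.pi fun _ => volume).IsAddHaarMeasure
  exact Measure.prod.instIsAddHaarMeasure (volume : Measure (Fin N → ℝ))
    (volume : Measure ({p : Fin N × Fin N // p.1 < p.2} → ℝ × ℝ))

open MeasureTheory in
theorem integrable_exp_sub_trace (R : ℝ) {b : ℝ} (hb : 0 < b) :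
    Integrable (fun x : HermCoord N =>
      Real.exp (R * ‖x‖ ^ 2 - b * (hermMatrix x ^ 4).trace.re)) := by
  refine (integrable_exp_sub_pow_four volume R hb).mono'
    (Continuous.aestronglyMeasurable ?_) (Filter.Eventually.of_forall fun x => ?_)
  · have := continuous_hermMatrix (N := N)
    have : Continuous fun x : HermCoord N => (hermMatrix x ^ 4).trace.re :=
      Complex.continuous_re.comp (Continuous.matrix_trace (this.pow 4))
    fun_prop
  · rw [Real.norm_eq_abs, Real.abs_exp, Real.exp_le_exp]
    have := norm_pow_four_le_trace x
    nlinarith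

/-! ### Unitary conjugation and Lebesgue measure. -/

/-- Conjugation `Φ ↦ U Φ Uᴴ` in real coordinates. -/
def conjLin (U : Matrix (Fin N) (Fin N) ℂ) : HermCoord N →ₗ[ℝ] HermCoord N where
  toFun x := hermCoord (U * hermMatrix x * U.conjTranspose)
  map_add' x y := by
    rw [hermMatrix_add, mul_add, add_mul]
    ext <;> simp [hermCoord]
  map_smul' c x := by
    rw [hermMatrix_smul, mul_smul_comm, smul_mul_assoc]
    ext <;> simp [hermCoord]

theorem hermMatrix_conjLin (U : Matrix (Fin N) (Fin N) ℂ) (x : HermCoord N) :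
    hermMatrix (conjLin U x) = U * hermMatrix x * U.conjTranspose :=
  hermMatrix_hermCoord (Matrix.isHermitian_mul_mul_conjTranspose U (hermMatrix_isHermitian x))

theorem conjLin_conjTranspose_conjLin {U : Matrix (Fin N) (Fin N) ℂ}
    (hU : U.conjTranspose * U = 1) (x : HermCoord N) : conjLin U.conjTranspose (conjLin U x) = x := by
  rw [← hermCoord_hermMatrix (conjLin U.conjTranspose (conjLin U x)), hermMatrix_conjLin,
    hermMatrix_conjLin, Matrix.conjTranspose_conjTranspose, ← mul_assoc, ← mul_assoc, hU, one_mul,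
    mul_assoc, hU, mul_one, hermCoord_hermMatrix]

theorem conj_pow {U : Matrix (Fin N) (Fin N) ℂ} (hU : U.conjTranspose * U = 1)
    (A : Matrix (Fin N) (Fin N) ℂ) (k : ℕ) :
    (U * A * U.conjTranspose) ^ (k + 1) = U * A ^ (k + 1) * U.conjTranspose := by
  induction k with
  | zero => simp
  | succ k ih =>
    rw [pow_succ, ih]
    calc _ = U * A ^ (k + 1) * (U.conjTranspose * U) * A * U.conjTranspose := by noncomm_ring
      _ = _ := by rw [hU, pow_succ A (k + 1)]; noncomm_ring

theorem trace_conj {U : Matrix (Fin N) (Fin N) ℂ} (hU : U.conjTranspose * U = 1)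
    (A : Matrix (Fin N) (Fin N) ℂ) : (U * A * U.conjTranspose).trace = A.trace := by
  rw [Matrix.trace_mul_comm, ← mul_assoc, hU, one_mul]

open MeasureTheory in
/-- Unitary conjugation preserves the Lebesgue measure on Hermitian matrices. -/
theorem map_conjLin {U : Matrix (Fin N) (Fin N) ℂ} (hU : U.conjTranspose * U = 1) :
    Measure.map (conjLin U) volume = volume := by
  have hinv : conjLin U.conjTranspose ∘ₗ conjLin U = LinearMap.id :=
    LinearMap.ext fun x => by
      rw [LinearMap.comp_apply, conjLin_conjTranspose_conjLin hU, LinearMap.id_apply]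
  have hdet : LinearMap.det (conjLin U) ≠ 0 := by
    intro h
    have := congrArg LinearMap.det hinv
    rw [LinearMap.det_comp, h, mul_zero, LinearMap.det_id] at this
    exact zero_ne_one this
  have hmap := Measure.map_linearMap_addHaar_eq_smul_addHaar
    (volume : Measure (HermCoord N)) hdet
  -- A linear map scales Haar measure by a constant. The set `Tr Φ² < 1` is invariant under
  -- conjugation and has finite positive volume, which forces that constant to be 1.
  set B : Set (HermCoord N) := {x | (hermMatrix x ^ 2).trace.re < 1} with hB
  have hBo : IsOpen B := isOpen_lt (Complex.continuous_re.comp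
    (Continuous.matrix_trace (continuous_hermMatrix.pow 2))) continuous_const
  have hB0 : volume B ≠ 0 := by
    refine (hBo.measure_pos volume ⟨0, ?_⟩).ne'
    have : hermMatrix (0 : HermCoord N) = 0 := (hermCLM N).map_zero
    simp [hB, this]
  have hBf : volume B ≠ ⊤ := by
    refine ((measure_mono ?_).trans_lt
      (measure_closedBall_lt_top (x := (0 : HermCoord N)) (r := 1))).ne
    intro x hx
    rw [mem_closedBall_zero_iff]
    refine norm_le_of_entry_le zero_le_one fun i j => ?_
    have hx' : (hermMatrix x ^ 2).trace.re < 1 := hx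
    rw [trace_sq_re (hermMatrix_isHermitian x)] at hx'
    have h1 : ‖hermMatrix x i j‖ ^ 2 ≤ ∑ i, ∑ j, ‖hermMatrix x i j‖ ^ 2 :=
      (Finset.single_le_sum (f := fun j => ‖hermMatrix x i j‖ ^ 2) (fun _ _ => sq_nonneg _)
        (Finset.mem_univ j)).trans (Finset.single_le_sum
          (f := fun i => ∑ j, ‖hermMatrix x i j‖ ^ 2)
          (fun _ _ => Finset.sum_nonneg fun _ _ => sq_nonneg _) (Finset.mem_univ i))
    nlinarith [norm_nonneg (hermMatrix x i j)]
  have hpre : conjLin U ⁻¹' B = B := by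
    ext x
    simp only [hB, Set.mem_preimage, Set.mem_ofPred_eq]
    rw [hermMatrix_conjLin, conj_pow hU, trace_conj hU]
  have hvol := congrArg (fun μ => μ B) hmap
  simp only [Measure.smul_apply, smul_eq_mul] at hvol
  rw [Measure.map_apply (LinearMap.continuous_of_finiteDimensional _).measurable
    hBo.measurableSet, hpre] at hvol
  have hc : ENNReal.ofReal |(LinearMap.det (conjLin U))⁻¹| = 1 :=
    ((ENNReal.mul_left_inj hB0 hBf).1 ((one_mul _).trans hvol)).symm
  rw [hmap, hc, one_smul]

theorem continuous_weight (H : Matrix (Fin N) (Fin N) ℂ) (η : ℝ) : Continuous (weight H η) := by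
  have h2 : Continuous fun x : HermCoord N => hermMatrix x ^ 2 := continuous_hermMatrix.pow 2
  have h4 : Continuous fun x : HermCoord N => hermMatrix x ^ 4 := continuous_hermMatrix.pow 4
  unfold weight action
  refine Real.continuous_exp.comp (Continuous.neg (Complex.continuous_re.comp
    (continuous_const.mul (Continuous.matrix_trace ?_))))
  exact (continuous_const.mul h2).add ((continuous_const_smul ((η / 4 : ℝ) : ℂ)).comp h4)

open MeasureTheory in
theorem matrixPartition_conj {U : Matrix (Fin N) (Fin N) ℂ} (hU : U.conjTranspose * U = 1)
    (H : Matrix (Fin N) (Fin N) ℂ) (η : ℝ) :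
    matrixPartition (U * H * U.conjTranspose) η = matrixPartition H η := by
  have hm : Measurable (conjLin U) := (LinearMap.continuous_of_finiteDimensional _).measurable
  unfold matrixPartition
  rw [← map_conjLin hU, integral_map hm.aemeasurable
    (continuous_weight _ _).aestronglyMeasurable, map_conjLin hU]
  refine integral_congr_ae (Filter.Eventually.of_forall fun x => ?_)
  simp only [weight, action]
  have key : (U * H * U.conjTranspose * (U * hermMatrix x ^ (1 + 1) * U.conjTranspose)).trace =
      (H * hermMatrix x ^ (1 + 1)).trace := by
    rw [← trace_conj hU (H * _)]
    congr 1
    calc _ = U * H * (U.conjTranspose * U) * hermMatrix x ^ (1 + 1) * U.conjTranspose := by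
          noncomm_ring
      _ = _ := by rw [hU]; noncomm_ring
  rw [hermMatrix_conjLin, conj_pow hU, conj_pow hU, Matrix.trace_add, Matrix.trace_add,
    Matrix.trace_smul, Matrix.trace_smul, trace_conj hU, key]

/-! ### The partition function as a Laplace transform in `H`. -/

/-- The bilinear form `(A, H) ↦ -N Re Tr (H A)` on arrays. -/
def tracePairing (N : ℕ) : (Fin N → Fin N → ℂ) →L[ℝ] (Fin N → Fin N → ℂ) →L[ℝ] ℝ :=
  LinearMap.toContinuousLinearMap (LinearMap.toContinuousLinearMap.toLinearMap ∘ₗ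
    LinearMap.mk₂ ℝ (fun A H : Fin N → Fin N → ℂ =>
      -(N * (Matrix.of H * Matrix.of A).trace.re))
      (fun A B H => by rw [← Matrix.of_add_of, mul_add, Matrix.trace_add, Complex.add_re]; ring)
      (fun c A H => by rw [← Matrix.smul_of, mul_smul_comm, Matrix.trace_smul, Complex.smul_re,
        smul_eq_mul, smul_eq_mul]; ring)
      (fun A H K => by rw [← Matrix.of_add_of, add_mul, Matrix.trace_add, Complex.add_re]; ring)
      (fun c A H => by rw [← Matrix.smul_of, smul_mul_assoc, Matrix.trace_smul, Complex.smul_re,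
        smul_eq_mul, smul_eq_mul]; ring))

/-- The linear functional `H ↦ -N Re Tr (H Φ²)`. -/
def source (x : HermCoord N) : (Fin N → Fin N → ℂ) →L[ℝ] ℝ :=
  tracePairing N (Matrix.of.symm (hermMatrix x ^ 2))

theorem source_apply (x : HermCoord N) (H : Fin N → Fin N → ℂ) :
    source x H = -(N * (Matrix.of H * hermMatrix x ^ 2).trace.re) := rfl

theorem continuous_source : Continuous (source (N := N)) :=
  (tracePairing N).continuous.comp (continuous_hermMatrix.pow 2)

theorem exists_norm_source_le (N : ℕ) :
    ∃ C : ℝ, 0 ≤ C ∧ ∀ x : HermCoord N, ‖source x‖ ≤ C * ‖x‖ ^ 2 := by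
  obtain ⟨C, hC, h⟩ := exists_norm_hermMatrix_le N
  refine ⟨‖tracePairing N‖ * (N * C ^ 2), by positivity, fun x => ?_⟩
  refine ((tracePairing N).le_opNorm _).trans ?_
  rw [mul_assoc]
  gcongr
  refine (pi_norm_le_iff_of_nonneg (by positivity)).2 fun i =>
    (pi_norm_le_iff_of_nonneg (by positivity)).2 fun j => ?_
  rw [Matrix.of_symm_apply, pow_two (hermMatrix x), Matrix.mul_apply]
  calc _ ≤ ∑ _k : Fin N, (C * ‖x‖) * (C * ‖x‖) := by
        refine (norm_sum_le _ _).trans (Finset.sum_le_sum fun k _ => ?_)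
        rw [norm_mul]
        exact mul_le_mul (h x i k) (h x k j) (norm_nonneg _) (by positivity)
    _ = _ := by
        rw [Finset.sum_const, Finset.card_univ, Fintype.card_fin, nsmul_eq_mul]
        ring

/-- The quartic part `exp (-N (η/4) Tr Φ⁴)` of the weight. -/
def quarticWeight (η : ℝ) (x : HermCoord N) : ℝ :=
  Real.exp (-(N * (η / 4) * (hermMatrix x ^ 4).trace.re))

theorem weight_eq (H : Matrix (Fin N) (Fin N) ℂ) (η : ℝ) (x : HermCoord N) :
    weight H η x = Real.exp (source x (Matrix.of.symm H)) * quarticWeight η x := by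
  rw [weight, quarticWeight, ← Real.exp_add, source_apply, Equiv.apply_symm_apply, action, Matrix.trace_add,
    Matrix.trace_smul, ← Complex.ofReal_natCast, Complex.re_ofReal_mul, Complex.add_re, smul_eq_mul,
    Complex.re_ofReal_mul]
  ring_nf

theorem continuous_quarticWeight (η : ℝ) : Continuous (quarticWeight (N := N) η) :=
  Real.continuous_exp.comp (Continuous.neg (continuous_const.mul (Complex.continuous_re.comp
    (Continuous.matrix_trace (continuous_hermMatrix.pow 4)))))

open MeasureTheory in
-- The power `s` allows part of the quartic decay to be spent elsewhere; the dilation argument keeps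
-- only `s = 1/32`.
theorem integrable_exp_mul_rpow_quarticWeight {η : ℝ} (hη : 0 < η) (R : ℝ) {s : ℝ} (hs : 0 < s) :
    Integrable (fun x : HermCoord N => Real.exp (R * ‖source x‖) * quarticWeight η x ^ s) := by
  obtain ⟨C, hC, h⟩ := exists_norm_source_le N
  obtain ⟨b, hb, hbx⟩ : ∃ b : ℝ, 0 < b ∧ ∀ x : HermCoord N,
      b * (hermMatrix x ^ 4).trace.re ≤ s * (N * (η / 4)) * (hermMatrix x ^ 4).trace.re := by
    -- For `N = 0` the coefficient `s * (N * (η / 4))` vanishes, but so does the trace, and any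
    -- positive `b` serves.
    rcases Nat.eq_zero_or_pos N with rfl | hN
    · exact ⟨1, one_pos, fun x => by simp [Matrix.trace]⟩
    · exact ⟨s * (N * (η / 4)), by positivity, fun x => le_rfl⟩
  refine (integrable_exp_sub_trace (|R| * C) hb).mono' ?_ (Filter.Eventually.of_forall fun x => ?_)
  · exact ((Real.continuous_exp.comp (continuous_const.mul continuous_source.norm)).mul
      ((continuous_quarticWeight η).rpow_const fun x => Or.inr hs.le)).aestronglyMeasurable
  · rw [quarticWeight, ← Real.exp_mul, ← Real.exp_add, Real.norm_eq_abs, Real.abs_exp,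
      Real.exp_le_exp]
    have h1 : R * ‖source x‖ ≤ |R| * C * ‖x‖ ^ 2 := by
      rw [mul_assoc]
      exact mul_le_mul (le_abs_self R) (h x) (norm_nonneg _) (abs_nonneg R)
    linarith [hbx x]

open MeasureTheory in
theorem integrable_exp_mul_quarticWeight {η : ℝ} (hη : 0 < η) (R : ℝ) :
    Integrable (fun x : HermCoord N => Real.exp (R * ‖source x‖) * ‖quarticWeight η x‖) := by
  refine (integrable_exp_mul_rpow_quarticWeight hη R one_pos).congr
    (Filter.Eventually.of_forall fun x => ?_)
  simp [quarticWeight]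

open MeasureTheory in
theorem integrable_weight {η : ℝ} (hη : 0 < η) (H : Matrix (Fin N) (Fin N) ℂ) :
    Integrable (weight H η) := by
  refine (integrable_exp_mul_quarticWeight hη ‖Matrix.of.symm H‖).mono'
    (continuous_weight H η).aestronglyMeasurable (Filter.Eventually.of_forall fun x => ?_)
  rw [weight_eq, norm_mul, Real.norm_eq_abs, Real.abs_exp]
  gcongr
  exact (le_abs_self _).trans (((source x).le_opNorm _).trans_eq (mul_comm _ _))

theorem matrixPartition_eq_of_charpoly_eq {A B : Matrix (Fin N) (Fin N) ℂ} (hA : A.IsHermitian)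
    (hB : B.IsHermitian) (h : A.charpoly = B.charpoly) (η : ℝ) :
    matrixPartition A η = matrixPartition B η := by
  have he := (hA.eigenvalues_eq_eigenvalues_iff hB).2 h
  have key : ∀ {C : Matrix (Fin N) (Fin N) ℂ} (hC : C.IsHermitian), matrixPartition C η =
      matrixPartition (Matrix.diagonal fun i => (hC.eigenvalues i : ℂ)) η := fun {C} hC => by
    conv_lhs => rw [hC.spectral_theorem]
    exact matrixPartition_conj (Unitary.coe_star_mul_self hC.eigenvectorUnitary) _ η
  rw [key hA, key hB, he]

/-- This dimension is the exponent in the Jacobian of a dilation, hence the origin of the `N²` in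
the operator. -/
theorem finrank_hermCoord (N : ℕ) : Module.finrank ℝ (HermCoord N) = N ^ 2 := by
  have hc : 2 * Fintype.card {p : Fin N × Fin N // p.1 < p.2} + N = N ^ 2 := by
    have h1 : Fintype.card {p : Fin N × Fin N // p.1 < p.2} =
        Fintype.card {p : Fin N × Fin N // p.2 < p.1} :=
      Fintype.card_congr ((Equiv.prodComm _ _).subtypeEquiv fun p => Iff.rfl)
    have h2 : Fintype.card {p : Fin N × Fin N // p.1 = p.2} = N := by
      rw [Fintype.card_congr (Equiv.subtypeProdEquivSigmaSubtype (fun a b : Fin N => a = b))]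
      simp
    have h3 : (Finset.univ : Finset (Fin N × Fin N)).card = N ^ 2 := by
      simp [pow_two]
    rw [Fintype.card_subtype] at h1 h2 ⊢
    rw [Fintype.card_subtype] at h1
    rw [← Finset.card_filter_add_card_filter_not (fun p : Fin N × Fin N => p.1 < p.2),
      ← Finset.card_filter_add_card_filter_not (s := Finset.univ.filter fun p => ¬ _)
        (fun p : Fin N × Fin N => p.1 = p.2), Finset.filter_filter, Finset.filter_filter] at h3
    have e1 : (Finset.univ.filter fun p : Fin N × Fin N => ¬ p.1 < p.2 ∧ p.1 = p.2) =
        Finset.univ.filter fun p => p.1 = p.2 := by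
      ext p; simp; omega
    have e2 : (Finset.univ.filter fun p : Fin N × Fin N => ¬ p.1 < p.2 ∧ ¬ p.1 = p.2) =
        Finset.univ.filter fun p => p.2 < p.1 := by
      ext p; simp; omega
    rw [e1, e2] at h3
    omega
  rw [Module.finrank_prod, Module.finrank_pi, Module.finrank_pi_fintype]
  simp [Module.finrank_prod]
  omega

theorem matrixPartition_eq (η : ℝ) (v : Fin N → Fin N → ℂ) :
    matrixPartition (Matrix.of v) η =
      laplaceIntegral MeasureTheory.volume source (quarticWeight η) v := by
  simp only [matrixPartition, weight_eq, laplaceIntegral, Equiv.symm_apply_apply, smul_eq_mul]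

/-! ### Unitary invariance to second order. -/

section
attribute [local instance] Matrix.linftyOpNormedRing Matrix.linftyOpNormedAlgebra

/-- The derivative of `t ↦ e^{tX} B e^{-tX}`, entrywise. -/
theorem hasDerivAt_exp_conj (X B : Matrix (Fin N) (Fin N) ℂ) (t : ℝ) :
    HasDerivAt (fun t : ℝ => Matrix.of.symm
        (NormedSpace.exp (t • X) * B * NormedSpace.exp (-(t • X))))
      (Matrix.of.symm (NormedSpace.exp (t • X) * (X * B - B * X) * NormedSpace.exp (-(t • X)))) t := by
  have h1 := hasDerivAt_exp_smul_const (𝕂 := ℝ) X t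
  have h2 := hasDerivAt_exp_smul_const' (𝕂 := ℝ) (-X) t
  have h3 := (h1.mul_const B).mul h2
  simp only [smul_neg] at h3
  have e : NormedSpace.exp (t • X) * (X * B - B * X) * NormedSpace.exp (-(t • X)) =
      NormedSpace.exp (t • X) * X * B * NormedSpace.exp (-(t • X)) +
      NormedSpace.exp (t • X) * B * (-X * NormedSpace.exp (-(t • X))) := by
    noncomm_ring
  rw [e]
  exact h3
end

theorem exp_conjTranspose_mul_self {X : Matrix (Fin N) (Fin N) ℂ} (hX : X.conjTranspose = -X)
    (t : ℝ) : (NormedSpace.exp (t • X)).conjTranspose = NormedSpace.exp (-(t • X)) ∧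
    (NormedSpace.exp (t • X)).conjTranspose * NormedSpace.exp (t • X) = 1 := by
  have h1 : (NormedSpace.exp (t • X)).conjTranspose = NormedSpace.exp (-(t • X)) := by
    rw [← Matrix.exp_conjTranspose, Matrix.conjTranspose_smul, hX, star_trivial, smul_neg]
  refine ⟨h1, ?_⟩
  have hc : Commute (-(t • X)) (t • X) := (Commute.refl (t • X)).neg_left
  rw [h1, ← Matrix.exp_add_of_commute _ _ hc, neg_add_cancel,
    NormedSpace.exp_zero]

variable {η : ℝ}

/-- Infinitesimal form, to second order, of the unitary invariance of the partition function. -/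
theorem laplaceIntegralDeriv2_commutator (hη : 0 < η) {X : Matrix (Fin N) (Fin N) ℂ}
    (hX : X.conjTranspose = -X) (D : Matrix (Fin N) (Fin N) ℂ) :
    laplaceIntegralDeriv2 MeasureTheory.volume source (quarticWeight η) (Matrix.of.symm D)
        (Matrix.of.symm (X * D - D * X)) (Matrix.of.symm (X * D - D * X)) +
      laplaceIntegralDeriv MeasureTheory.volume source (quarticWeight η) (Matrix.of.symm D)
        (Matrix.of.symm (X * (X * D - D * X) - (X * D - D * X) * X)) = 0 := by
  have ha := continuous_source (N := N).aestronglyMeasurable (μ := MeasureTheory.volume)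
  have hg := (continuous_quarticWeight (N := N) η).aestronglyMeasurable
    (μ := MeasureTheory.volume)
  have hint := integrable_exp_mul_quarticWeight (N := N) hη
  set c : Matrix (Fin N) (Fin N) ℂ → ℝ → (Fin N → Fin N → ℂ) := fun B t =>
    Matrix.of.symm (NormedSpace.exp (t • X) * B * NormedSpace.exp (-(t • X))) with hc
  have hc' : ∀ B t, HasDerivAt (c B) (c (X * B - B * X) t) t := hasDerivAt_exp_conj X
  have hc0 : ∀ B, c B 0 = Matrix.of.symm B := fun B => by simp [hc]
  have hconst : ∀ t, laplaceIntegral MeasureTheory.volume source (quarticWeight η) (c D t) =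
      laplaceIntegral MeasureTheory.volume source (quarticWeight η) (c D 0) := fun t => by
    obtain ⟨h1, h2⟩ := exp_conjTranspose_mul_self hX t
    rw [← matrixPartition_eq, ← matrixPartition_eq, hc0]
    simp only [hc, Equiv.apply_symm_apply]
    rw [← h1, matrixPartition_conj h2]
  -- The first-order identity is needed along the whole orbit, not just at `t = 0`, so that it can
  -- be differentiated again. Both the base point and the direction move with `t`, which produces
  -- the two terms.
  have hd : ∀ t, laplaceIntegralDeriv MeasureTheory.volume source (quarticWeight η) (c D t)
      (c (X * D - D * X) t) = 0 := fun t => by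
    have h1 := (hasFDerivAt_laplaceIntegral ha hg hint (c D t)).comp_hasDerivAt t (hc' D t)
    refine h1.unique ?_
    have h2 : laplaceIntegral MeasureTheory.volume source (quarticWeight η) ∘ c D =
      fun _ => laplaceIntegral MeasureTheory.volume source (quarticWeight η) (c D 0) :=
      funext hconst
    rw [h2]
    exact hasDerivAt_const _ _
  have h3 := ((hasFDerivAt_laplaceIntegralDeriv ha hg hint (c D 0)).comp_hasDerivAt 0
    (hc' D 0)).clm_apply (hc' (X * D - D * X) 0)
  have h4 := h3.unique ((hasDerivAt_const (0 : ℝ) (0 : ℝ)).congr_of_eventuallyEq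
    (Filter.Eventually.of_forall hd))
  rw [Function.comp_apply, hc0, hc0, hc0] at h4
  exact h4

/-! ### The dilation identity. -/

open MeasureTheory in
/-- The virial identity obtained from the dilations `Φ ↦ c Φ`. -/
theorem dilation_identity (hη : 0 < η) (v : Fin N → Fin N → ℂ) :
    (N : ℝ) ^ 2 * laplaceIntegral volume source (quarticWeight η) v +
      2 * laplaceIntegralDeriv volume source (quarticWeight η) v v =
    N * η * ∫ x : HermCoord N, (hermMatrix x ^ 4).trace.re *
      (Real.exp (source x v) * quarticWeight η x) := by
  have ha := continuous_source (N := N).aestronglyMeasurable (μ := volume)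
  have hg := (continuous_quarticWeight (N := N) η).aestronglyMeasurable (μ := volume)
  have hint := integrable_exp_mul_quarticWeight (N := N) hη
  set q : HermCoord N → ℝ := fun x => N * (η / 4) * (hermMatrix x ^ 4).trace.re with hq
  have hqc : Continuous q := continuous_const.mul (Complex.continuous_re.comp
    (Continuous.matrix_trace (continuous_hermMatrix.pow 4)))
  have hsc : Continuous fun x : HermCoord N => source x v :=
    continuous_source.clm_apply continuous_const
  have hq0 : ∀ x, 0 ≤ q x := fun x =>
    mul_nonneg (by positivity) ((by positivity : (0 : ℝ) ≤ ‖x‖ ^ 4).trans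
      (norm_pow_four_le_trace x))
  set F : ℝ → HermCoord N → ℝ := fun c x => Real.exp (c ^ 2 * source x v - c ^ 4 * q x) with hF
  set F' : ℝ → HermCoord N → ℝ := fun c x =>
    Real.exp (c ^ 2 * source x v - c ^ 4 * q x) * (2 * c * source x v - 4 * c ^ 3 * q x) with hF'
  have hF1 : ∀ x, F 1 x = Real.exp (source x v) * quarticWeight η x := fun x => by
    rw [quarticWeight, ← Real.exp_add]
    simp only [hF, hq]
    ring_nf
  have hscale : ∀ c x, F c x = F 1 (c • x) := fun c x => by
    have e1 : source (c • x) v = c ^ 2 * source x v := by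
      rw [source_apply, source_apply, hermMatrix_smul, smul_pow, mul_smul_comm,
        Matrix.trace_smul, Complex.smul_re, smul_eq_mul]
      ring
    have e2 : q (c • x) = c ^ 4 * q x := by
      simp only [hq]
      rw [hermMatrix_smul, smul_pow, Matrix.trace_smul, Complex.smul_re, smul_eq_mul]
      ring
    simp only [hF, e1, e2]
    ring_nf
  have hFc : ∀ c, Continuous (F c) := fun c => by fun_prop
  have hboth := hasDerivAt_integral_of_dominated_loc_of_deriv_le (μ := volume) (F := F) (F' := F')
    (x₀ := (1 : ℝ)) (s := Metric.ball 1 (1 / 2))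
    -- For `c` within `1/2` of 1: `c² ≤ 9/4`, `c³ ≤ 27/8`, `c⁴ ≥ 1/16`. The polynomial factor is at
    -- most `432 * (|source x v| + q x / 32)`, where `432 / 32 = 4 * 27/8`; bounding the bracket by
    -- its exponential leaves `9/4 + 1 = 13/4` and `1/16 - 1/32 = 1/32`.
    (bound := fun x => 432 * (Real.exp ((13 / 4 * ‖v‖) * ‖source x‖) *
      quarticWeight η x ^ (1 / 32 : ℝ)))
    (Metric.ball_mem_nhds _ (by norm_num))
    (Filter.Eventually.of_forall fun c => (hFc c).aestronglyMeasurable)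
    ((integrable_exp_smul ha hg hint v).congr (Filter.Eventually.of_forall fun x => (hF1 x).symm))
    (Continuous.aestronglyMeasurable (by fun_prop)) ?_
    ((integrable_exp_mul_rpow_quarticWeight hη _ (by norm_num)).const_mul _) ?_
  rotate_left
  · refine Filter.Eventually.of_forall fun x c hc => ?_
    rw [Metric.mem_ball, Real.dist_eq, abs_lt] at hc
    obtain ⟨hc1, hc2⟩ : 1 / 2 ≤ c ∧ c ≤ 3 / 2 := ⟨by linarith, by linarith⟩
    have hc0 : 0 ≤ c := by linarith
    have b2 : c ^ 2 ≤ 9 / 4 := by nlinarith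
    have b3 : c ^ 3 ≤ 27 / 8 := by
      calc c ^ 3 ≤ (3 / 2) ^ 3 := by gcongr
        _ = 27 / 8 := by norm_num
    have b4 : 1 / 16 ≤ c ^ 4 := by
      calc (1 / 16 : ℝ) = (1 / 2) ^ 4 := by norm_num
        _ ≤ c ^ 4 := by gcongr
    have hs : |source x v| ≤ ‖v‖ * ‖source x‖ := ((source x).le_opNorm v).trans_eq (mul_comm _ _)
    have f1 : |2 * c * source x v - 4 * c ^ 3 * q x| ≤ 432 * (|source x v| + q x / 32) := by
      calc _ ≤ |2 * c * source x v| + |4 * c ^ 3 * q x| := abs_sub _ _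
        _ = 2 * c * |source x v| + 4 * c ^ 3 * q x := by
          rw [abs_mul, abs_of_nonneg (by positivity : 0 ≤ 2 * c),
            abs_of_nonneg (mul_nonneg (by positivity) (hq0 x))]
        _ ≤ 2 * (3 / 2) * |source x v| + 4 * (27 / 8) * q x := by
          have := hq0 x
          gcongr
        _ ≤ _ := by linarith [hq0 x, abs_nonneg (source x v)]
    have f2 : |source x v| + q x / 32 ≤ Real.exp (|source x v| + q x / 32) := by
      linarith [Real.add_one_le_exp (|source x v| + q x / 32)]
    have f3 : c ^ 2 * source x v - c ^ 4 * q x ≤ 9 / 4 * |source x v| - 1 / 16 * q x := by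
      have g1 : c ^ 2 * source x v ≤ 9 / 4 * |source x v| := by
        calc c ^ 2 * source x v ≤ c ^ 2 * |source x v| := by gcongr; exact le_abs_self _
          _ ≤ _ := by gcongr
      have g2 : 1 / 16 * q x ≤ c ^ 4 * q x := mul_le_mul_of_nonneg_right b4 (hq0 x)
      linarith
    have hw : quarticWeight η x ^ (1 / 32 : ℝ) = Real.exp (-(q x) * (1 / 32)) := by
      rw [quarticWeight, ← Real.exp_mul]
    rw [hw, ← Real.exp_add]
    simp only [hF']
    rw [norm_mul, Real.norm_eq_abs, Real.abs_exp, Real.norm_eq_abs]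
    calc _ ≤ Real.exp (9 / 4 * |source x v| - 1 / 16 * q x) *
          (432 * Real.exp (|source x v| + q x / 32)) := by
          gcongr
          exact f1.trans (by gcongr)
      _ = 432 * Real.exp (13 / 4 * |source x v| + -(q x) * (1 / 32)) := by
          rw [mul_left_comm, ← Real.exp_add]
          ring_nf
      _ ≤ _ := by
          gcongr 432 * Real.exp (?_ + _)
          rw [mul_assoc]
          gcongr
  · refine Filter.Eventually.of_forall fun x c _ => ?_
    have h1 := (((hasDerivAt_pow 2 c).mul_const (source x v)).sub
      ((hasDerivAt_pow 4 c).mul_const (q x))).exp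
    have e : F' c x = Real.exp (c ^ 2 * source x v - c ^ 4 * q x) *
        ((2 : ℕ) * c ^ (2 - 1) * source x v - (4 : ℕ) * c ^ (4 - 1) * q x) := by
      simp only [hF']
      norm_num
    rw [e]
    exact h1
  obtain ⟨hint', hder⟩ := hboth
  -- Change of variables `x ↦ c • x`: the left side does not depend on `c > 0`, so its derivative at
  -- 1 vanishes.
  have hcn : ∀ c : ℝ, 0 < c → c ^ (N ^ 2) * ∫ x, F c x = ∫ x, F 1 x := fun c hc => by
    simp only [hscale c]
    rw [Measure.integral_comp_smul volume (F 1) c, finrank_hermCoord, abs_of_pos (by positivity),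
      smul_eq_mul, mul_inv_cancel_left₀ (by positivity)]
  have hprod := (hasDerivAt_pow (N ^ 2) (1 : ℝ)).mul hder
  have hzero := hprod.unique ((hasDerivAt_const (1 : ℝ) (∫ x, F 1 x)).congr_of_eventuallyEq
    ((lt_mem_nhds one_pos).mono fun c hc => hcn c hc))
  have e1 : ∫ x, F 1 x = laplaceIntegral volume source (quarticWeight η) v := by
    simp only [hF1, laplaceIntegral, smul_eq_mul]
  have e2 : ∫ x, F' 1 x = 2 * laplaceIntegralDeriv volume source (quarticWeight η) v v -
      N * η * ∫ x : HermCoord N, (hermMatrix x ^ 4).trace.re *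
        (Real.exp (source x v) * quarticWeight η x) := by
    -- The domination argument already makes `F' 1` integrable, and the `Tr Φ⁴` integrand is the
    -- difference of twice the source term and `F' 1`.
    rw [← integral_const_mul, laplaceIntegralDeriv_apply ha hg hint, ← integral_const_mul,
      eq_sub_iff_add_eq, ← eq_sub_iff_add_eq', ← integral_sub
      ((integrable_apply_mul_exp ha hg hint v v).const_mul 2) hint']
    refine integral_congr_ae (Filter.Eventually.of_forall fun x => ?_)
    beta_reduce
    rw [← hF1 x]
    simp only [hF, hF', hq]
    ring
  rw [e1, e2] at hzero
  simp at hzero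
  linarith

/-! ### Derivatives in the eigenvalues. -/

/-- The array `diag(E)` as a continuous linear function of `E`. -/
def diagCLM (N : ℕ) : (Fin N → ℝ) →L[ℝ] (Fin N → Fin N → ℂ) :=
  LinearMap.toContinuousLinearMap
    { toFun := fun E => Matrix.of.symm (Matrix.diagonal fun i => (E i : ℂ))
      map_add' := fun E F => by
        ext i j
        by_cases h : i = j <;> simp [Matrix.diagonal, h]
      map_smul' := fun c E => by
        ext i j
        by_cases h : i = j <;> simp [Matrix.diagonal, h] }

theorem diagCLM_apply (E : Fin N → ℝ) :
    diagCLM N E = Matrix.of.symm (Matrix.diagonal fun i => (E i : ℂ)) := rfl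

theorem diagCLM_single (i : Fin N) :
    diagCLM N (Pi.single i 1) = Matrix.of.symm (Matrix.single i i 1) := by
  rw [diagCLM_apply]
  congr 1
  ext a b
  simp only [Matrix.diagonal_apply, Matrix.single_apply, Pi.single_apply]
  grind [Complex.ofReal_zero, Complex.ofReal_one]

variable {η : ℝ}

theorem partitionFunction_eq (η : ℝ) (E : Fin N → ℝ) : partitionFunction η E =
    laplaceIntegral MeasureTheory.volume source (quarticWeight η) (diagCLM N E) :=
  matrixPartition_eq η (diagCLM N E)

theorem contDiff_partitionFunction (hη : 0 < η) (n : ℕ) :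
    ContDiff ℝ n (partitionFunction (N := N) η) := by
  have h := contDiff_integral_exp_smul continuous_source.aestronglyMeasurable n
    (continuous_quarticWeight (N := N) η).aestronglyMeasurable
    (integrable_exp_mul_quarticWeight (N := N) hη)
  rw [funext (partitionFunction_eq η)]
  exact h.comp (diagCLM N).contDiff

theorem partialE_partitionFunction (hη : 0 < η) (i : Fin N) :
    partialE i (partitionFunction η) = fun E =>
      laplaceIntegralDeriv MeasureTheory.volume source (quarticWeight η) (diagCLM N E)
        (diagCLM N (Pi.single i 1)) := by
  funext E
  have h := (hasFDerivAt_laplaceIntegral continuous_source.aestronglyMeasurable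
    (continuous_quarticWeight (N := N) η).aestronglyMeasurable
    (integrable_exp_mul_quarticWeight (N := N) hη) (diagCLM N E)).comp E (diagCLM N).hasFDerivAt
  rw [partialE, funext (partitionFunction_eq η)]
  exact (h.hasLineDerivAt _).lineDeriv

theorem partialE_partialE_partitionFunction (hη : 0 < η) (i : Fin N) (E : Fin N → ℝ) :
    partialE i (partialE i (partitionFunction η)) E =
      laplaceIntegralDeriv2 MeasureTheory.volume source (quarticWeight η) (diagCLM N E)
        (diagCLM N (Pi.single i 1)) (diagCLM N (Pi.single i 1)) := by
  have h := (hasFDerivAt_laplaceIntegralDeriv continuous_source.aestronglyMeasurable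
    (continuous_quarticWeight (N := N) η).aestronglyMeasurable
    (integrable_exp_mul_quarticWeight (N := N) hη) (diagCLM N E)).comp E (diagCLM N).hasFDerivAt
  have h' := h.clm_apply (hasFDerivAt_const (diagCLM N (Pi.single i 1)) E)
  rw [partialE, partialE_partitionFunction hη]
  refine (h'.hasLineDerivAt (Pi.single i 1)).lineDeriv.trans ?_
  simp

/-! ### Off-diagonal second derivatives and the quartic moment. -/

/-- The Hermitian direction `e_ij + e_ji`. -/
def symDir (i j : Fin N) : Matrix (Fin N) (Fin N) ℂ := Matrix.single i j 1 + Matrix.single j i 1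

/-- The skew-Hermitian direction `e_ij - e_ji`. -/
def skewDir (i j : Fin N) : Matrix (Fin N) (Fin N) ℂ := Matrix.single i j 1 - Matrix.single j i 1

theorem symDir_conjTranspose (i j : Fin N) : (symDir i j).conjTranspose = symDir i j := by
  simp [symDir, Matrix.conjTranspose_single, add_comm]

theorem skewDir_conjTranspose (i j : Fin N) : (skewDir i j).conjTranspose = -skewDir i j := by
  simp [skewDir, Matrix.conjTranspose_single]

theorem skewDir_commutator_diagonal (i j : Fin N) (E : Fin N → ℝ) :
    skewDir i j * Matrix.diagonal (fun i => (E i : ℂ)) -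
      Matrix.diagonal (fun i => (E i : ℂ)) * skewDir i j = (E j - E i) • symDir i j := by
  ext a b
  simp only [skewDir, symDir, Matrix.sub_apply, Matrix.mul_diagonal, Matrix.diagonal_mul,
    Matrix.single_apply, Matrix.smul_apply, Matrix.add_apply, Complex.real_smul, Complex.ofReal_sub]
  grind

theorem symDir_commutator_diagonal (i j : Fin N) (E : Fin N → ℝ) :
    symDir i j * Matrix.diagonal (fun i => (E i : ℂ)) -
      Matrix.diagonal (fun i => (E i : ℂ)) * symDir i j = (E j - E i) • skewDir i j := by
  ext a b
  simp only [skewDir, symDir, Matrix.sub_apply, Matrix.mul_diagonal, Matrix.diagonal_mul,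
    Matrix.single_apply, Matrix.smul_apply, Matrix.add_apply, Complex.real_smul, Complex.ofReal_sub]
  grind

theorem skewDir_commutator_symDir {i j : Fin N} (h : i ≠ j) :
    skewDir i j * symDir i j - symDir i j * skewDir i j =
      (2 : ℝ) • (Matrix.single i i 1 - Matrix.single j j 1) := by
  simp only [skewDir, symDir, sub_mul, mul_add, add_mul, mul_sub,
    Matrix.single_mul_single_same, Matrix.single_mul_single_of_ne _ _ _ _ h,
    Matrix.single_mul_single_of_ne _ _ _ _ h.symm, mul_one]
  module

/-- Second-order perturbation theory in a direction generated by a rotation. -/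
theorem laplaceIntegralDeriv2_eq (hη : 0 < η) {E : Fin N → ℝ} {i j : Fin N} (hE : E i ≠ E j)
    {X K : Matrix (Fin N) (Fin N) ℂ} (hX : X.conjTranspose = -X)
    (h1 : X * Matrix.diagonal (fun i => (E i : ℂ)) - Matrix.diagonal (fun i => (E i : ℂ)) * X =
      (E j - E i) • K)
    (h2 : X * K - K * X = (2 : ℝ) • (Matrix.single i i 1 - Matrix.single j j 1)) :
    laplaceIntegralDeriv2 MeasureTheory.volume source (quarticWeight η) (diagCLM N E)
        (Matrix.of.symm K) (Matrix.of.symm K) =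
      2 * ((E i - E j)⁻¹ * (partialE i (partitionFunction η) E -
        partialE j (partitionFunction η) E)) := by
  have h := laplaceIntegralDeriv2_commutator hη hX (Matrix.diagonal fun i => (E i : ℂ))
  have hs : ∀ (c : ℝ) (A : Matrix (Fin N) (Fin N) ℂ),
      Matrix.of.symm (c • A) = c • Matrix.of.symm A := fun _ _ => rfl
  have hsub : ∀ A B : Matrix (Fin N) (Fin N) ℂ,
      Matrix.of.symm (A - B) = Matrix.of.symm A - Matrix.of.symm B := fun _ _ => rfl
  rw [h1, mul_smul_comm, smul_mul_assoc, ← smul_sub, h2, hs, hs, hs, hsub, ← diagCLM_apply,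
    ← diagCLM_single, ← diagCLM_single] at h
  simp only [map_smul, map_sub, smul_apply, smul_eq_mul] at h
  rw [partialE_partitionFunction hη, partialE_partitionFunction hη]
  have hd : E i - E j ≠ 0 := sub_ne_zero.2 hE
  field_simp
  -- The identity `h` is quadratic in `E_j - E_i`, so one such factor has to be restored before
  -- comparing.
  apply mul_left_cancel₀ hd
  linear_combination h

theorem source_single (x : HermCoord N) (i j : Fin N) (c : ℂ) :
    (Matrix.single i j c * hermMatrix x ^ 2).trace = c * (hermMatrix x ^ 2) j i := by
  rw [Matrix.trace_single_mul]
  simp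

/-- Pairing `Φ²` with `e_ij + e_ji` and `i (e_ij - e_ji)` yields `2 Re (Φ²)_ij` and `2 Im (Φ²)_ij`;
the factor `1/4` undoes the two squared 2's. -/
theorem trace_pow_four_eq (x : HermCoord N) :
    (N : ℝ) ^ 2 * (hermMatrix x ^ 4).trace.re = ∑ i,
      (source x (diagCLM N (Pi.single i 1)) ^ 2 + ∑ j ∈ Finset.univ.erase i,
        1 / 4 * (source x (Matrix.of.symm (symDir i j)) ^ 2 +
          source x (Matrix.of.symm (Complex.I • skewDir i j)) ^ 2)) := by
  have hM := (hermMatrix_isHermitian x).pow 2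
  rw [show hermMatrix x ^ 4 = (hermMatrix x ^ 2) ^ 2 by rw [← pow_mul], trace_sq_re hM,
    Finset.mul_sum]
  refine Finset.sum_congr rfl fun i _ => ?_
  rw [← Finset.add_sum_erase _ _ (Finset.mem_univ i), mul_add, Finset.mul_sum]
  congr 1
  · rw [diagCLM_single, source_apply, Equiv.apply_symm_apply, source_single, one_mul,
      sq_apply_self (hermMatrix_isHermitian x), Complex.ofReal_re, Complex.norm_real,
      Real.norm_eq_abs, sq_abs]
    ring
  · refine Finset.sum_congr rfl fun j _ => ?_
    have hji : (hermMatrix x ^ 2) j i = star ((hermMatrix x ^ 2) i j) := (hM.apply j i).symm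
    rw [source_apply, source_apply, Equiv.apply_symm_apply, Equiv.apply_symm_apply, symDir,
      skewDir, smul_mul_assoc, add_mul, sub_mul, Matrix.trace_smul, Matrix.trace_add,
      Matrix.trace_sub, source_single, source_single, hji, ← Complex.normSq_eq_norm_sq,
      Complex.normSq_apply]
    simp
    ring

open MeasureTheory in
-- Integrated against the weight, each squared source becomes a second derivative of `Z`. The two
-- off-diagonal directions contribute equally, and `1/4 * (2 + 2) = 1` gives the coefficient of the
-- difference quotient.
theorem integral_trace_pow_four (hη : 0 < η) {E : Fin N → ℝ} (hE : ∀ i j, i ≠ j → E i ≠ E j) :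
    (N : ℝ) ^ 2 * ∫ x : HermCoord N, (hermMatrix x ^ 4).trace.re *
      (Real.exp (source x (diagCLM N E)) * quarticWeight η x) =
    ∑ i, partialE i (partialE i (partitionFunction η)) E +
      ∑ i, ∑ j ∈ Finset.univ.erase i, (E i - E j)⁻¹ *
        (partialE i (partitionFunction η) E - partialE j (partitionFunction η) E) := by
  have ha := continuous_source (N := N).aestronglyMeasurable (μ := volume)
  have hg := (continuous_quarticWeight (N := N) η).aestronglyMeasurable (μ := volume)
  have hint := integrable_exp_mul_quarticWeight (N := N) hη
  have hI : ∀ K, Integrable fun x : HermCoord N => source x K ^ 2 *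
      (Real.exp (source x (diagCLM N E)) * quarticWeight η x) := fun K => by
    simpa only [pow_two] using integrable_apply_mul_apply_mul_exp ha hg hint (diagCLM N E) K K
  have hV : ∀ K, ∫ x : HermCoord N, source x K ^ 2 *
      (Real.exp (source x (diagCLM N E)) * quarticWeight η x) =
      laplaceIntegralDeriv2 volume source (quarticWeight η) (diagCLM N E) K K := fun K => by
    simp only [pow_two, laplaceIntegralDeriv2_apply ha hg hint]
  rw [← integral_const_mul]
  simp only [← mul_assoc ((N : ℝ) ^ 2), trace_pow_four_eq]
  simp only [Finset.sum_mul, add_mul, mul_assoc (1 / 4 : ℝ)]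
  have hI2 : ∀ i j : Fin N, Integrable fun x : HermCoord N =>
      1 / 4 * (source x (Matrix.of.symm (symDir i j)) ^ 2 *
          (Real.exp (source x (diagCLM N E)) * quarticWeight η x) +
        source x (Matrix.of.symm (Complex.I • skewDir i j)) ^ 2 *
          (Real.exp (source x (diagCLM N E)) * quarticWeight η x)) := fun i j =>
    ((hI _).add (hI _)).const_mul _
  have hI3 : ∀ i : Fin N, Integrable fun x : HermCoord N => ∑ j ∈ Finset.univ.erase i,
      1 / 4 * (source x (Matrix.of.symm (symDir i j)) ^ 2 *
          (Real.exp (source x (diagCLM N E)) * quarticWeight η x) +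
        source x (Matrix.of.symm (Complex.I • skewDir i j)) ^ 2 *
          (Real.exp (source x (diagCLM N E)) * quarticWeight η x)) := fun i =>
    integrable_finsetSum _ fun j _ => hI2 i j
  have hI4 : ∀ i : Fin N, Integrable fun x : HermCoord N =>
      source x (diagCLM N (Pi.single i 1)) ^ 2 *
          (Real.exp (source x (diagCLM N E)) * quarticWeight η x) +
        ∑ j ∈ Finset.univ.erase i,
          1 / 4 * (source x (Matrix.of.symm (symDir i j)) ^ 2 *
              (Real.exp (source x (diagCLM N E)) * quarticWeight η x) +
            source x (Matrix.of.symm (Complex.I • skewDir i j)) ^ 2 *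
              (Real.exp (source x (diagCLM N E)) * quarticWeight η x)) := fun i =>
    (hI _).add (hI3 i)
  rw [integral_finsetSum _ fun i _ => hI4 i,
    ← Finset.sum_add_distrib]
  refine Finset.sum_congr rfl fun i _ => ?_
  rw [integral_add (hI _) (hI3 i), hV,
    partialE_partialE_partitionFunction hη, integral_finsetSum _ fun j _ => hI2 i j]
  congr 1
  refine Finset.sum_congr rfl fun j hj => ?_
  have hij : i ≠ j := (Finset.ne_of_mem_erase hj).symm
  rw [integral_const_mul, integral_add (hI _) (hI _), hV, hV,
    laplaceIntegralDeriv2_eq hη (hE i j hij) (skewDir_conjTranspose i j)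
      (skewDir_commutator_diagonal i j E) (skewDir_commutator_symDir hij),
    -- The direction `i (e_ij - e_ji)` is generated by the skew-Hermitian `i (e_ij + e_ji)`; the
    -- sign from `i² = -1` swaps the commutator back to the one already computed.
    laplaceIntegralDeriv2_eq hη (hE i j hij) (X := Complex.I • symDir i j)
      (by rw [Matrix.conjTranspose_smul, symDir_conjTranspose]; simp)
      (by rw [smul_mul_assoc, mul_smul_comm, ← smul_sub, symDir_commutator_diagonal, smul_comm])
      (by
        rw [smul_mul_smul_comm, smul_mul_smul_comm, Complex.I_mul_I, ← smul_sub,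
          ← skewDir_commutator_symDir hij, neg_one_smul, neg_sub])]
  ring

/-! ### The Schwinger–Dyson equation. -/

theorem schwingerDyson_partitionFunction (hη : 0 < η) {E : Fin N → ℝ}
    (hE : ∀ i j, i ≠ j → E i ≠ E j) : schwingerDyson η (partitionFunction η) E = 0 := by
  have h1 := dilation_identity hη (diagCLM N E)
  have h2 := integral_trace_pow_four hη hE
  have h3 : laplaceIntegralDeriv MeasureTheory.volume source (quarticWeight η) (diagCLM N E)
      (diagCLM N E) = ∑ k, E k * partialE k (partitionFunction η) E := by
    -- Since `diag(E) = ∑ E_k e_kk`, the derivative of `Z` along its own argument is the Euler field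
    -- in the eigenvalues.
    conv_lhs => arg 2; rw [pi_eq_sum_univ' E, map_sum]
    rw [map_sum]
    refine Finset.sum_congr rfl fun k _ => ?_
    rw [partialE_partitionFunction hη, map_smul, map_smul, smul_eq_mul]
  rw [h3, ← partitionFunction_eq] at h1
  have h4 : N * η * ∫ x : HermCoord N, (hermMatrix x ^ 4).trace.re *
      (Real.exp (source x (diagCLM N E)) * quarticWeight η x) = η / N * ((N : ℝ) ^ 2 *
        ∫ x : HermCoord N, (hermMatrix x ^ 4).trace.re *
          (Real.exp (source x (diagCLM N E)) * quarticWeight η x)) := by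
    rcases eq_or_ne (N : ℝ) 0 with h | h
    · simp [h]
    · field_simp
  rw [h4, h2] at h1
  rw [schwingerDyson]
  linear_combination -h1

end PhiFour
end

theorem mainTheorem2 (N : ℕ) (η : ℝ) (hη : 0 < η) (E : Fin N → ℝ)
    (hpos : ∀ i, 0 < E i) (hdist : ∀ i j, i ≠ j → E i ≠ E j) :
    -- the partition function is a convergent integral that depends on the eigenvalues only
    (∀ H : Matrix (Fin N) (Fin N) ℂ, H.PosDef →
      H.charpoly = ∏ i, (Polynomial.X - Polynomial.C (E i : ℂ)) →
        MeasureTheory.Integrable (PhiFour.weight H η) ∧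
          PhiFour.matrixPartition H η = PhiFour.partitionFunction η E) ∧
    -- it is twice continuously differentiable near `E`
    ContDiffAt ℝ 2 (PhiFour.partitionFunction η) E ∧
    -- and it is annihilated by the Schwinger–Dyson operator
    PhiFour.schwingerDyson η (PhiFour.partitionFunction η) E = 0 := by
  refine ⟨fun H hH hchar => ⟨PhiFour.integrable_weight hη H, ?_⟩,
    (PhiFour.contDiff_partitionFunction hη 2).contDiffAt,
    PhiFour.schwingerDyson_partitionFunction hη hdist⟩
  have hD : (Matrix.diagonal fun i => (E i : ℂ)).IsHermitian :=
    Matrix.isHermitian_diagonal_of_self_adjoint _ (funext fun i => Complex.conj_ofReal (E i))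
  refine PhiFour.matrixPartition_eq_of_charpoly_eq hH.isHermitian hD ?_ η
  rw [hchar, Matrix.charpoly_diagonal]
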